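/- A tournament is an orientation of a finite complete graph; its score sequence is the list of the out-degrees of its vertices in nondecreasing order. Let $S_n$ ($n\ge 0$) be the set of score sequences $s=(s_0,\dots,s_{n-1})$ of tournaments on $n$ vertices, and $T_n\subseteq S_n$ the set of strong ones, i.e. those that are score sequences of a (nonempty) strongly connected tournament. For $u\in S_k$ and $v\in S_\ell$ let $u\oplus v\in S_{k+\ell}$ be $u$ followed by the sequence obtained from $v$ by adding $k$ to each entry. Every score sequence can be written uniquely as $s=t_1\oplus\cdots\oplus t_k$ with $t_1,\dots,t_k$ strong score sequences, called the strong summands of $s$. For $n\ge 1$ let $\mathrm{EGZ}_n$ be the set of multisets of size $n$ with elements in $\mathbb{Z}/n\mathbb{Z}$ whose sum is $\binom n2$ modulo $n$. For a multiset $M$ over $\mathbb{Z}/n\mathbb{Z}$ let $|M|_0$ be the multiplicity of $0$ in $M$; for $s\in S_n$ and $i\in\{0,\dots,n-1\}$ let $|s^{-1}(i)|$ be the number of $j$ with $s_j=i$. For $s \in S_n$ and an integer $j$ let $\mu(s+j)$ be the multiset $\{s_0+j,\dots,s_{n-1}+j\}$ over $\mathbb{Z}/n\mathbb{Z}$. **Lemma.**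 Let $n\ge 1$ and let $L_n$ be the set of pairs $(s,i)\in S_n\times\{0,\dots,n-1\}$ such that, if $s=t_1\oplus\cdots\oplus t_k$ is the decomposition of $s$ into its strong summands, then $n-|t_k|\le i\le n-1$, where $|t_k|$ is the length of $t_k$. Then $f(s,i)=\mu(s-i)$ defines a bijection $f:L_n\to\mathrm{EGZ}_n$. Moreover, $|f(s,i)|_0=|s^{-1}(i)|$ for all $(s,i)\in L_n$. In terms of the generating functions $$\mathrm{EGZ}(x,t)=\sum_{n\ge1}\Bigl(\sum_{M\in\mathrm{EGZ}_n}t^{|M|_0}\Bigr)x^n,\qquad S(x)=\sum_{n\ge0}|S_n|\,x^n,\qquad T^{\mathrm{pt}}(x,t)=\sum_{n\ge1}\Bigl(\sum_{s\in T_n}\sum_{i=0}^{n-1}t^{|s^{-1}(i)|}\Bigr)x^n,$$ we have, as formal power series in $x$ with coefficients in $\mathbb{Z}[t]$, $$\mathrm{EGZ}(x,t)=S(x)\,T^{\mathrm{pt}}(x,t).$$ -/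

import Mathlib

namespace ScoreSeq

/-- A tournament: an orientation of the complete graph on `V`. -/
def IsTournament {V : Type*} (G : Digraph V) : Prop :=
  (∀ v, ¬ G.Adj v v) ∧ ∀ v w, v ≠ w → Xor (G.Adj v w) (G.Adj w v)

open Classical in
/-- The number of wins (the out-degree) of the vertex `v`. -/
noncomputable def score {V : Type*} [Fintype V] (G : Digraph V) (v : V) : ℕ :=
  (Finset.univ.filter fun w => G.Adj v w).card

/-- The scores of all vertices, arranged in nondecreasing order. -/
noncomputable def scoreList {V : Type*} [Fintype V] (G : Digraph V) : List ℕ :=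
  ((Finset.univ : Finset V).val.map (score G)).sort (· ≤ ·)

/-- The graph is nonempty and there is a directed path from each vertex to each vertex. -/
def IsStronglyConnected {V : Type*} (G : Digraph V) : Prop :=
  Nonempty V ∧ ∀ v w : V, Relation.ReflTransGen G.Adj v w

/-- `S_n`: the score sequences of length `n`. -/
def scoreSeqs (n : ℕ) : Set (List ℕ) :=
  {s | ∃ G : Digraph (Fin n), IsTournament G ∧ scoreList G = s}

/-- `T_n`: the strong score sequences of length `n`. -/
def strongSeqs (n : ℕ) : Set (List ℕ) :=
  {s | ∃ G : Digraph (Fin n), IsTournament G ∧ IsStronglyConnected G ∧ scoreList G = s}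

/-- The direct sum `u ⊕ v`. -/
def dsum (u v : List ℕ) : List ℕ := u ++ v.map (· + u.length)

/-- The direct sum `t₁ ⊕ ⋯ ⊕ tₖ` of a list of sequences. -/
def dsumList (ts : List (List ℕ)) : List ℕ := ts.foldr dsum []

/-- `ts = [t₁, …, tₖ]` is a decomposition `s = t₁ ⊕ ⋯ ⊕ tₖ` of `s` into
(nonempty) strong score sequences. -/
def IsStrongDecomposition (s : List ℕ) (ts : List (List ℕ)) : Prop :=
  (∀ t ∈ ts, t ∈ strongSeqs t.length) ∧ s = dsumList ts

/-- The pointed score sequences of length `n`: the product of `S_n` with `[0, n - 1]`. -/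
def pointedSeqs (n : ℕ) : Set (List ℕ × ℕ) := scoreSeqs n ×ˢ Set.Iio n

/-- The pointed strong score sequences of length `n`: the product of `T_n` with `[0, n - 1]`. -/
def pointedStrongSeqs (n : ℕ) : Set (List ℕ × ℕ) := strongSeqs n ×ˢ Set.Iio n

/-- `L_n`: the pointed score sequences `(s, i)` of length `n` whose distinguished position `i`
lies in the last strong summand of `s`, that is `n - |tₖ| ≤ i` (and `i ≤ n - 1`). -/
def lastSet (n : ℕ) : Set (List ℕ × ℕ) :=
  {p | p ∈ pointedSeqs n ∧ ∃ (ts : List (List ℕ)) (h : ts ≠ []),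
    IsStrongDecomposition p.1 ts ∧ n ≤ p.2 + (ts.getLast h).length}

/-- `EGZ_n`: the multisets of size `n` over `ℤ/nℤ` with sum `n choose 2`. -/
def egz (n : ℕ) : Set (Multiset (ZMod n)) :=
  {M | M.card = n ∧ M.sum = ((n.choose 2 : ℕ) : ZMod n)}

/-- `μ(s + j)`: the multiset of the `s_k + j`, taken in `ℤ/nℤ`. -/
def mu (n : ℕ) (s : List ℕ) (j : ℤ) : Multiset (ZMod n) :=
  (s : Multiset ℕ).map fun a => (a : ZMod n) + (j : ZMod n)

theorem finite_digraph (n : ℕ) : Finite (Digraph (Fin n)) :=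
  Finite.of_injective (fun G : Digraph (Fin n) => G.Adj) fun _ _ h => Digraph.ext h

theorem finite_pointedStrongSeqs (n : ℕ) : (pointedStrongSeqs n).Finite := by
  have := finite_digraph n
  refine Set.Finite.prod ((Set.finite_range fun G : Digraph (Fin n) => scoreList G).subset ?_)
    (Set.finite_Iio n)
  rintro s ⟨G, -, -, rfl⟩
  exact ⟨G, rfl⟩

theorem finite_scoreSeqs (n : ℕ) : (scoreSeqs n).Finite := by
  have := finite_digraph n
  refine (Set.finite_range fun G : Digraph (Fin n) => scoreList G).subset ?_
  rintro s ⟨G, -, rfl⟩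
  exact ⟨G, rfl⟩

theorem finite_egz (n : ℕ) : (egz n).Finite := by
  rcases n with _ | n
  · refine (Set.finite_singleton (0 : Multiset (ZMod 0))).subset ?_
    rintro M ⟨h, -⟩
    exact Multiset.card_eq_zero.mp h
  · refine (Set.finite_range fun m : Sym (ZMod (n + 1)) (n + 1) =>
      (m : Multiset (ZMod (n + 1)))).subset ?_
    rintro M ⟨h, -⟩
    exact ⟨⟨M, h⟩, rfl⟩

/-- The polynomial `EGZ_n(t)`, the sum of `t ^ |M|₀` over `M ∈ EGZ_n`. -/
noncomputable def egzPoly (n : ℕ) : Polynomial ℤ :=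
  ∑ M ∈ (finite_egz n).toFinset, Polynomial.X ^ M.count 0

/-- The polynomial `T^pt_n(t)`, the sum of `t ^ |s⁻¹(i)|` over the pointed strong score
sequences `(s, i)` of length `n`. -/
noncomputable def pointedStrongPoly (n : ℕ) : Polynomial ℤ :=
  ∑ p ∈ (finite_pointedStrongSeqs n).toFinset, Polynomial.X ^ p.1.count p.2

/-- `EGZ(x, t) = ∑_{n ≥ 1} EGZ_n(t) xⁿ`, a power series in `x` over `ℤ[t]`. -/
noncomputable def egzSeries : PowerSeries (Polynomial ℤ) :=
  PowerSeries.mk fun n => if n = 0 then 0 else egzPoly n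

/-- `S(x) = ∑_{n ≥ 0} |S_n| xⁿ`. -/
noncomputable def scoreSeries : PowerSeries (Polynomial ℤ) :=
  PowerSeries.mk fun n => (((finite_scoreSeqs n).toFinset.card : ℕ) : Polynomial ℤ)

/-- `T^pt(x, t) = ∑_{n ≥ 1} T^pt_n(t) xⁿ`. -/
noncomputable def pointedStrongSeries : PowerSeries (Polynomial ℤ) :=
  PowerSeries.mk fun n => if n = 0 then 0 else pointedStrongPoly n

end ScoreSeq

/-!
# Zero-sum multisets and pointed score sequences

By Landau's theorem, score sequences and strong score sequences are described by inequalities between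
the partial sums of a list and the numbers `k.choose 2`. Necessity and the role of strong
connectedness come from counting the arcs that leave a set of vertices (`sum_score_eq`), sufficiency
from Hall's marriage theorem (`IsLandau.exists_tournament`). A score sequence splits as a direct sum
exactly where equality holds, so `(s, i) ∈ L_n` means that Landau's inequality for `s` is strict at
all proper positions beyond `i` (`mem_lastSet_iff`).

The bijection is a cycle lemma. The integers whose residues lie in `M ∈ EGZ_n`, taken with
multiplicity, form a nondecreasing sequence `A` with `A (k + n) = A k + n`. A shift of the index
changes the sum of `A k - k` over a period by `n`; the condition on the sum of `M` says that this sum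
is divisible by `n`, so exactly one indexing makes it zero (`exists_isLift`, `IsLift.unique`). Then the
partial sums `excess A` are `n`-periodic. If `μ(s - i) = M`, the sequence `s` is the period of `A`
starting at `p = n - i`, lowered by `p`. Landau's inequalities for `s` say that `p` minimizes
`excess A`, and the condition that `i` lies in the last strong summand says that `p` is the first
positive minimizer (`mem_lastSet_iff_isFirstArgmin`). There is exactly one such `p`, and it is at most
`n`.

For the generating functions, cutting off the last strong summand identifies `L_n` with the union over
`k + l = n` of the products of `S_k` with the pointed strong score sequences of length `l`
(`sum_lastSet`), and the entries of the first part do not interfere with the count of `i`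
(`count_dsum`).
-/

namespace ScoreSeq

open Finset

/-! ### Landau's theorem -/

/-- Landau's conditions on a list of naturals: it is nondecreasing, the sum of its first `k` entries
is at least `k.choose 2` for every `k`, and its total sum is `s.length.choose 2`. -/
structure IsLandau (s : List ℕ) : Prop where
  sorted : s.Pairwise (· ≤ ·)
  le_sum : ∀ k ≤ s.length, k.choose 2 ≤ (s.take k).sum
  sum_eq : s.sum = s.length.choose 2

/-- The strong version of Landau's conditions: the list is nonempty, and the inequality is strict for
all proper nonempty initial segments. -/
structure IsStrongLandau (s : List ℕ) : Prop extends IsLandau s where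
  ne_nil : s ≠ []
  lt_sum : ∀ k, 0 < k → k < s.length → k.choose 2 < (s.take k).sum

theorem sum_take_eq_sum_range (s : List ℕ) {k : ℕ} (hk : k ≤ s.length) :
    (s.take k).sum = ∑ j ∈ range k, s.getD j 0 := by
  induction k with
  | zero => simp
  | succ k ih =>
    rw [List.sum_take_succ _ _ (by omega), ih (by omega), sum_range_succ,
      List.getD_eq_getElem _ _ (by omega)]

theorem getD_mono {s : List ℕ} (hs : s.Pairwise (· ≤ ·)) {i j : ℕ} (hij : i ≤ j)
    (hj : j < s.length) : s.getD i 0 ≤ s.getD j 0 := by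
  rw [List.getD_eq_getElem _ _ (by omega), List.getD_eq_getElem _ _ hj]
  rcases hij.eq_or_lt with rfl | h
  · exact le_rfl
  · exact List.pairwise_iff_getElem.mp hs i j _ hj h

/-- Among the sets of vertices of a given size, the one with the smallest scores is initial. -/
theorem sum_range_card_le {n : ℕ} {f : ℕ → ℕ} (hf : ∀ i j, i ≤ j → j < n → f i ≤ f j)
    (W : Finset (Fin n)) : ∑ j ∈ range #W, f j ≤ ∑ v ∈ W, f v := by
  induction W using Finset.induction_on_max with
  | empty => simp
  | insert a s ha ih =>
    have has : a ∉ s := fun h => (ha a h).false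
    have hc : #s ≤ a := by
      have : s ⊆ Finset.Iio a := fun x hx => by simpa using ha x hx
      simpa using Finset.card_le_card this
    rw [card_insert_of_notMem has, sum_range_succ, sum_insert has, add_comm]
    exact Nat.add_le_add (hf _ _ hc a.2) ih

section Tournament

variable {V : Type*} [DecidableEq V] {G : Digraph V}

open Classical in
/-- Each of the games played inside `A` contributes one win. -/
theorem card_adj_inside (hG : IsTournament G) (A : Finset V) :
    #{p ∈ A ×ˢ A | G.Adj p.1 p.2} = (#A).choose 2 := by
  have h1 : #{p ∈ A ×ˢ A | G.Adj p.2 p.1} = #{p ∈ A ×ˢ A | G.Adj p.1 p.2} := by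
    refine Finset.card_equiv (Equiv.prodComm V V) fun p => ?_
    simp [and_comm]
  have h2 : #{p ∈ A ×ˢ A | G.Adj p.1 p.2} + #{p ∈ A ×ˢ A | G.Adj p.2 p.1} = #A.offDiag := by
    rw [← card_union_of_disjoint]
    · congr 1
      ext ⟨v, w⟩
      have := hG.2 v w
      have h3 := hG.1 v
      simp only [mem_union, mem_filter, mem_product, mem_offDiag]
      by_cases hvw : v = w
      · subst hvw; simp [h3]
      · have := (this hvw).or
        tauto
    · rw [Finset.disjoint_left]
      rintro ⟨v, w⟩ h h'
      simp only [mem_filter] at h h'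
      have hvw : v ≠ w := by rintro rfl; exact hG.1 _ h.2
      rcases hG.2 v w hvw with ⟨-, h3⟩ | ⟨-, h3⟩
      · exact h3 h'.2
      · exact h3 h.2
  rw [offDiag_card] at h2
  rw [Nat.choose_two_right, Nat.mul_sub, mul_one]
  omega

variable [Fintype V]

open Classical in
theorem sum_score_eq (hG : IsTournament G) (A : Finset V) :
    ∑ v ∈ A, score G v = (#A).choose 2 + #{p ∈ A ×ˢ Aᶜ | G.Adj p.1 p.2} := by
  rw [← card_adj_inside hG A, ← card_union_of_disjoint]
  · rw [← filter_union, ← product_union, union_compl]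
    simp only [score, card_filter, sum_product]
  · refine Finset.disjoint_filter_filter ?_
    rw [Finset.disjoint_left]
    rintro ⟨v, w⟩ h h'
    simp only [mem_product, mem_compl] at h h'
    exact h'.2 h.2

/-- An arc of `G` leaves every nonempty proper set of vertices when `G` is strongly connected. -/
theorem exists_adj_of_isStronglyConnected (hs : IsStronglyConnected G) {A : Finset V}
    (h0 : A.Nonempty) (h1 : A ≠ univ) : ∃ v ∈ A, ∃ w ∉ A, G.Adj v w := by
  obtain ⟨v, hv⟩ := h0
  obtain ⟨w, hw⟩ : ∃ w, w ∉ A := by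
    by_contra! h
    exact h1 (by ext; simp [h])
  by_contra! h
  have key : ∀ x, Relation.ReflTransGen G.Adj v x → x ∈ A := by
    intro x hx
    induction hx with
    | refl => exact hv
    | tail _ hbc ih =>
      by_contra hc
      exact h _ ih _ hc hbc
  exact hw (key w (hs.2 v w))

theorem choose_two_lt_sum_score (hG : IsTournament G) (hs : IsStronglyConnected G)
    {A : Finset V} (h0 : A.Nonempty) (h1 : A ≠ univ) :
    (#A).choose 2 < ∑ v ∈ A, score G v := by
  classical
  obtain ⟨v, hv, w, hw, hvw⟩ := exists_adj_of_isStronglyConnected hs h0 h1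
  rw [sum_score_eq hG A]
  have : 0 < #{p ∈ A ×ˢ Aᶜ | G.Adj p.1 p.2} :=
    card_pos.mpr ⟨(v, w), by simp [hv, hw, hvw]⟩
  omega

/-- If every nonempty proper set of vertices has more wins than internal games, then the tournament
is strongly connected: no arc leaves the set of vertices that can be reached from a given one. -/
theorem isStronglyConnected_of_lt [Nonempty V] (hG : IsTournament G)
    (h : ∀ A : Finset V, A.Nonempty → A ≠ univ → (#A).choose 2 < ∑ v ∈ A, score G v) :
    IsStronglyConnected G := by
  classical
  refine ⟨inferInstance, fun v w => ?_⟩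
  by_contra hw
  let A : Finset V := {x | Relation.ReflTransGen G.Adj v x}
  have hlt := h A ⟨v, by simp [A, Relation.ReflTransGen.refl]⟩ fun hA => hw <| by
    have : w ∈ A := hA ▸ mem_univ w
    simpa [A] using this
  rw [sum_score_eq hG A] at hlt
  have : #{p ∈ A ×ˢ Aᶜ | G.Adj p.1 p.2} = 0 := by
    rw [card_eq_zero, filter_eq_empty_iff]
    rintro ⟨x, y⟩ hxy hadj
    simp only [A, mem_product, mem_compl, mem_filter, mem_univ, true_and] at hxy
    exact hxy.2 (hxy.1.tail hadj)
  omega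

end Tournament

/-- The relabelling of a tournament along a permutation of its vertices. -/
def relabel {n : ℕ} (σ : Equiv.Perm (Fin n)) (G : Digraph (Fin n)) : Digraph (Fin n) :=
  ⟨fun v w => G.Adj (σ v) (σ w)⟩

theorem IsTournament.relabel {n : ℕ} {G : Digraph (Fin n)} (hG : IsTournament G)
    (σ : Equiv.Perm (Fin n)) : IsTournament (relabel σ G) :=
  ⟨fun v => hG.1 (σ v), fun _ _ h => hG.2 _ _ (σ.injective.ne h)⟩

theorem IsStronglyConnected.relabel {n : ℕ} {G : Digraph (Fin n)} (hG : IsStronglyConnected G)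
    (σ : Equiv.Perm (Fin n)) : IsStronglyConnected (relabel σ G) := by
  refine ⟨hG.1, fun v w => ?_⟩
  have := (hG.2 (σ v) (σ w)).lift (p := (ScoreSeq.relabel σ G).Adj) σ.symm fun a b h => by
    simpa [ScoreSeq.relabel, Function.onFun] using h
  simpa [Function.onFun] using this

theorem score_relabel {n : ℕ} (G : Digraph (Fin n)) (σ : Equiv.Perm (Fin n)) (v : Fin n) :
    score (relabel σ G) v = score G (σ v) := by
  classical
  refine Finset.card_equiv σ fun w => ?_
  · rw [mem_filter, mem_filter]
    exact and_congr (by simp) Iff.rfl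

/-- A score list is realized by a tournament whose vertices are labelled in the order of scores. -/
theorem exists_sorting {n : ℕ} (G : Digraph (Fin n)) :
    ∃ σ : Equiv.Perm (Fin n), ∀ v : Fin n, score (relabel σ G) v = (scoreList G).getD v 0 := by
  refine ⟨Tuple.sort (score G), fun v => ?_⟩
  have h : scoreList G = List.ofFn (score G ∘ Tuple.sort (score G)) := by
    refine List.Perm.eq_of_pairwise' (Multiset.pairwise_sort _ _)
      (List.pairwise_ofFn.mpr fun _ _ hij => Tuple.monotone_sort (score G) hij.le) ?_
    rw [← Multiset.coe_eq_coe, scoreList, Multiset.sort_eq, List.ofFn_eq_map, ← Multiset.map_coe]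
    have : ((List.finRange n : List (Fin n)) : Multiset (Fin n)) = (univ : Finset (Fin n)).val := rfl
    rw [this, ← Multiset.map_map, ← (Tuple.sort (score G)).coe_toEmbedding, ← map_val,
      Finset.map_univ_equiv]
  rw [score_relabel, h, List.getD_eq_getElem _ _ (by simp)]
  simp

theorem scoreList_eq {n : ℕ} {G : Digraph (Fin n)} {s : List ℕ} (hl : s.length = n)
    (hs : s.Pairwise (· ≤ ·)) (h : ∀ v : Fin n, score G v = s.getD v 0) : scoreList G = s := by
  refine List.Perm.eq_of_pairwise' (Multiset.pairwise_sort _ _) hs ?_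
  rw [← Multiset.coe_eq_coe, scoreList, Multiset.sort_eq]
  have : ((List.finRange n : List (Fin n)) : Multiset (Fin n)) = (univ : Finset (Fin n)).val := rfl
  rw [← this, Multiset.map_coe, ← List.ofFn_eq_map, Multiset.coe_eq_coe]
  refine List.Perm.of_eq (List.ext_getElem (by simp [hl]) fun i h1 h2 => ?_)
  simp [h, h2]

theorem mem_scoreSeqs_iff {n : ℕ} {s : List ℕ} :
    s ∈ scoreSeqs n ↔ s.length = n ∧ s.Pairwise (· ≤ ·) ∧
      ∃ G : Digraph (Fin n), IsTournament G ∧ ∀ v : Fin n, score G v = s.getD v 0 := by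
  constructor
  · rintro ⟨G, hG, rfl⟩
    obtain ⟨σ, hσ⟩ := exists_sorting G
    exact ⟨by simp [scoreList], Multiset.pairwise_sort _ _, _, hG.relabel σ, hσ⟩
  · rintro ⟨hl, hs, G, hG, h⟩
    exact ⟨G, hG, scoreList_eq hl hs h⟩

theorem mem_strongSeqs_iff {n : ℕ} {s : List ℕ} :
    s ∈ strongSeqs n ↔ s.length = n ∧ s.Pairwise (· ≤ ·) ∧
      ∃ G : Digraph (Fin n), IsTournament G ∧ IsStronglyConnected G ∧
        ∀ v : Fin n, score G v = s.getD v 0 := by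
  constructor
  · rintro ⟨G, hG, hc, rfl⟩
    obtain ⟨σ, hσ⟩ := exists_sorting G
    exact ⟨by simp [scoreList], Multiset.pairwise_sort _ _, _, hG.relabel σ, hc.relabel σ, hσ⟩
  · rintro ⟨hl, hs, G, hG, hc, h⟩
    exact ⟨G, hG, hc, scoreList_eq hl hs h⟩

theorem sum_take_eq_sum_filter {n : ℕ} {s : List ℕ} (hl : s.length = n) {k : ℕ} (hk : k ≤ n) :
    (s.take k).sum = ∑ v : Fin n with v.val < k, s.getD v 0 := by
  rw [sum_take_eq_sum_range s (hl ▸ hk)]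
  symm
  refine Finset.sum_bij (fun v _ => v.val) (by simp) (by simp [Fin.val_inj]) ?_ (by simp)
  intro b hb
  have := mem_range.mp hb
  exact ⟨⟨b, by omega⟩, by simpa using hb, rfl⟩

theorem sum_eq_sum_univ {n : ℕ} {s : List ℕ} (hl : s.length = n) :
    s.sum = ∑ v : Fin n, s.getD v 0 := by
  have h := sum_take_eq_sum_filter hl le_rfl
  rwa [List.take_of_length_le hl.le, filter_true_of_mem fun v _ => v.2] at h

theorem card_filter_lt {n k : ℕ} (hk : k ≤ n) : #{v : Fin n | v.val < k} = k := by
  simp [Fin.card_filter_val_lt, hk]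

theorem isLandau_of_score {n : ℕ} {s : List ℕ} (hl : s.length = n) (hs : s.Pairwise (· ≤ ·))
    {G : Digraph (Fin n)} (hG : IsTournament G) (h : ∀ v : Fin n, score G v = s.getD v 0) :
    IsLandau s := by
  have key : ∀ k ≤ n, k.choose 2 ≤ (s.take k).sum := by
    intro k hk
    have := sum_score_eq hG {v | v.val < k}
    rw [card_filter_lt hk] at this
    simp only [h] at this
    rw [sum_take_eq_sum_filter hl hk]
    omega
  refine ⟨hs, hl ▸ key, ?_⟩
  have := sum_score_eq hG univ
  rw [sum_eq_sum_univ hl, hl]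
  simpa [h] using this

/-- Landau's inequality for initial segments implies it for all sets of positions, since the list is
nondecreasing. -/
theorem IsLandau.choose_two_le {n : ℕ} {s : List ℕ} (hs : IsLandau s) (hl : s.length = n)
    (W : Finset (Fin n)) : (#W).choose 2 ≤ ∑ v ∈ W, s.getD v 0 := by
  have hW : #W ≤ s.length := by simpa [hl] using card_le_univ W
  refine (hs.le_sum _ hW).trans ?_
  rw [sum_take_eq_sum_range s hW]
  exact sum_range_card_le (fun i j hij hj => getD_mono hs.sorted hij (hl ▸ hj)) W

/-- Sufficiency of Landau's conditions. Give the vertex `v` as many slots as it should have wins; by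
Hall's theorem the games can be matched injectively to slots of one of their two players. The
matching is onto since there are as many slots as games, so every vertex wins as often as it
should. -/
theorem IsLandau.exists_tournament {n : ℕ} {s : List ℕ} (hs : IsLandau s) (hl : s.length = n) :
    ∃ G : Digraph (Fin n), IsTournament G ∧ ∀ v : Fin n, score G v = s.getD v 0 := by
  classical
  let ι := {e : Sym2 (Fin n) // ¬ e.IsDiag}
  let α := Σ v : Fin n, Fin (s.getD v 0)
  let t : ι → Finset α := fun e => {x | x.1 ∈ e.1}
  have hall : ∀ E : Finset ι, #E ≤ #(E.biUnion t) := by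
    intro E
    let W : Finset (Fin n) := {v | ∃ e ∈ E, v ∈ e.1}
    have hU : E.biUnion t = W.sigma fun v => (univ : Finset (Fin (s.getD v 0))) := by
      ext ⟨v, c⟩
      rw [mem_biUnion, mem_sigma]
      simp only [t, W, mem_filter, mem_univ, true_and, and_true]
    have hE : #E ≤ (#W).choose 2 := by
      rw [← Sym2.card_image_offDiag, ← card_map (Function.Embedding.subtype _)]
      refine card_le_card fun e he => ?_
      obtain ⟨⟨e, hd⟩, heE, rfl⟩ := mem_map.mp he
      induction e with
      | h a b =>
        refine mem_image.mpr ⟨(a, b), mem_offDiag.mpr ⟨?_, ?_, ?_⟩, rfl⟩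
        · exact mem_filter.mpr ⟨mem_univ _, _, heE, Sym2.mem_mk_left a b⟩
        · exact mem_filter.mpr ⟨mem_univ _, _, heE, Sym2.mem_mk_right a b⟩
        · simpa using hd
    rw [hU, card_sigma]
    simpa using hE.trans (hs.choose_two_le hl W)
  obtain ⟨m, hm, hmt⟩ := (Finset.all_card_le_biUnion_card_iff_exists_injective t).mp hall
  have hcard : Fintype.card ι = Fintype.card α := by
    have h1 : Fintype.card α = s.sum := by
      rw [sum_eq_sum_univ hl]
      simp [α]
    rw [h1, hs.sum_eq, hl, Sym2.card_subtype_not_diag, Fintype.card_fin]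
  have hbij : Function.Bijective m := (Fintype.bijective_iff_injective_and_card m).mpr ⟨hm, hcard⟩
  have hmem : ∀ e, (m e).1 ∈ e.1 := fun e => by simpa [t] using hmt e
  let G : Digraph (Fin n) := ⟨fun v w => ∃ h : ¬ s(v, w).IsDiag, (m ⟨s(v, w), h⟩).1 = v⟩
  refine ⟨G, ⟨fun v h => h.1 (by simp), fun v w hvw => ?_⟩, fun v => ?_⟩
  · have hd : ¬ s(v, w).IsDiag := by simpa using hvw
    have hd' : ¬ s(w, v).IsDiag := by simpa using hvw.symm
    have e : (⟨s(w, v), hd'⟩ : ι) = ⟨s(v, w), hd⟩ := Subtype.ext Sym2.eq_swap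
    have h1 : G.Adj v w ↔ (m ⟨s(v, w), hd⟩).1 = v := ⟨fun h => h.2, fun h => ⟨hd, h⟩⟩
    have h2 : G.Adj w v ↔ (m ⟨s(v, w), hd⟩).1 = w := by
      rw [← e]; exact ⟨fun h => h.2, fun h => ⟨hd', h⟩⟩
    rw [h1, h2]
    rcases Sym2.mem_iff.mp (hmem ⟨s(v, w), hd⟩) with h | h
    · exact Or.inl ⟨h, fun h' => hvw (h.symm.trans h')⟩
    · exact Or.inr ⟨h, fun h' => hvw (h'.symm.trans h)⟩
  · have h1 : score G v = #{e : ι | (m e).1 = v} := by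
      have hadj : ∀ {w}, w ∈ (@univ (Fin n) _).filter (G.Adj v) → G.Adj v w := fun hw =>
        (mem_filter.mp hw).2
      unfold score
      convert Finset.card_bij (s := (@univ (Fin n) _).filter (G.Adj v))
        (fun w hw => (⟨s(v, w), (hadj hw).1⟩ : ι)) ?_ ?_ ?_
      · intro w hw
        simpa using (hadj hw).2
      · intro a _ b _ hab
        exact Sym2.congr_right.mp (congrArg Subtype.val hab)
      · rintro ⟨e, he⟩ h
        have hv : (m ⟨e, he⟩).1 = v := by simpa using h
        have hve : v ∈ e := hv ▸ hmem ⟨e, he⟩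
        obtain ⟨w, rfl⟩ := hve
        exact ⟨w, by simpa [G] using ⟨by simpa using he, hv⟩, rfl⟩
    have h2 : #{e : ι | (m e).1 = v} = #{x : α | x.1 = v} :=
      Finset.card_equiv (Equiv.ofBijective m hbij) (by simp)
    have h3 : ({x : α | x.1 = v} : Finset α) =
        ({v} : Finset (Fin n)).sigma fun v => (univ : Finset (Fin (s.getD v 0))) := by
      ext ⟨w, c⟩
      rw [mem_sigma]
      simp
    rw [h1, h2, h3, card_sigma]
    simp

theorem mem_scoreSeqs {n : ℕ} {s : List ℕ} : s ∈ scoreSeqs n ↔ IsLandau s ∧ s.length = n := by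
  rw [mem_scoreSeqs_iff]
  constructor
  · rintro ⟨hl, hs, G, hG, h⟩
    exact ⟨isLandau_of_score hl hs hG h, hl⟩
  · rintro ⟨hs, hl⟩
    exact ⟨hl, hs.sorted, hs.exists_tournament hl⟩

theorem mem_strongSeqs {n : ℕ} {s : List ℕ} :
    s ∈ strongSeqs n ↔ IsStrongLandau s ∧ s.length = n := by
  rw [mem_strongSeqs_iff]
  constructor
  · rintro ⟨hl, hs, G, hG, hc, h⟩
    have : Nonempty (Fin n) := hc.1
    have hn : 0 < n := Fin.pos_iff_nonempty.mpr this
    refine ⟨⟨isLandau_of_score hl hs hG h, ?_, fun k hk hkn => ?_⟩, hl⟩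
    · rintro rfl; simp at hl; omega
    · rw [sum_take_eq_sum_filter hl (by omega)]
      have := choose_two_lt_sum_score hG hc (A := {v | v.val < k})
        ⟨⟨0, hn⟩, by simpa using hk⟩ fun hA => by
          have h1 := card_filter_lt (n := n) (k := k) (by omega)
          rw [hA, card_univ, Fintype.card_fin] at h1
          omega
      rw [card_filter_lt (by omega)] at this
      simpa only [h] using this
  · rintro ⟨hs, hl⟩
    obtain ⟨G, hG, h⟩ := hs.exists_tournament hl
    have hn : 0 < n := hl ▸ List.length_pos_iff.mpr hs.ne_nil
    have : Nonempty (Fin n) := ⟨⟨0, hn⟩⟩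
    refine ⟨hl, hs.sorted, G, hG, isStronglyConnected_of_lt hG fun A h0 h1 => ?_, h⟩
    have hA : #A < s.length := by
      simpa [hl] using card_lt_card (ssubset_univ_iff.mpr h1)
    simp only [h]
    refine (hs.lt_sum _ (card_pos.mpr h0) hA).trans_le ?_
    rw [sum_take_eq_sum_range s hA.le]
    exact sum_range_card_le (fun i j hij hj => getD_mono hs.sorted hij (hl ▸ hj)) A

/-! ### Direct sums and strong summands -/

theorem add_choose_two (a b : ℕ) : (a + b).choose 2 = a.choose 2 + b.choose 2 + b * a := by
  induction b with
  | zero => simp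
  | succ b ih =>
    have h1 : (a + b + 1).choose 2 = (a + b).choose 1 + (a + b).choose 2 := rfl
    have h2 : (b + 1).choose 2 = b.choose 1 + b.choose 2 := rfl
    rw [← add_assoc, h1, h2, ih, Nat.choose_one_right, Nat.choose_one_right]
    ring

@[simp]
theorem length_dsum (u v : List ℕ) : (dsum u v).length = u.length + v.length := by simp [dsum]

theorem dsum_assoc (u v w : List ℕ) : dsum (dsum u v) w = dsum u (dsum v w) := by
  simp [dsum, add_comm]

theorem take_dsum {u : List ℕ} (v : List ℕ) {k : ℕ} (hk : k ≤ u.length) :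
    (dsum u v).take k = u.take k := by
  rw [dsum, List.take_append_of_le_length hk]

theorem sum_map_add (v : List ℕ) (c : ℕ) : (v.map (· + c)).sum = v.sum + v.length * c := by
  induction v with
  | nil => simp
  | cons a v ih => simp only [List.map_cons, List.sum_cons, ih, List.length_cons]; ring

theorem sum_dsum (u v : List ℕ) : (dsum u v).sum = u.sum + v.sum + v.length * u.length := by
  rw [dsum, List.sum_append, sum_map_add, add_assoc]

theorem take_add_dsum (u v : List ℕ) (k : ℕ) :
    (dsum u v).take (u.length + k) = dsum u (v.take k) := by
  simp [dsum, List.take_length_add_append]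

theorem sum_take_dsum (u : List ℕ) {v : List ℕ} {k : ℕ} (hk : k ≤ v.length) :
    ((dsum u v).take (u.length + k)).sum = u.sum + (v.take k).sum + k * u.length := by
  rw [take_add_dsum, sum_dsum, List.length_take, min_eq_left hk]

theorem IsLandau.getElem_lt {s : List ℕ} (hs : IsLandau s) {i : ℕ} (hi : i < s.length) :
    s[i] < s.length := by
  have h1 : s[i] ≤ s[s.length - 1] := by
    have := getD_mono hs.sorted (i := i) (j := s.length - 1) (by omega) (by omega)
    rwa [List.getD_eq_getElem _ _ hi, List.getD_eq_getElem _ _ (by omega)] at this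
  obtain ⟨m, hm⟩ : ∃ m, s.length = m + 1 := ⟨s.length - 1, by omega⟩
  have h2 := hs.le_sum m (by omega)
  have h3 := hs.sum_eq
  have h4 := List.sum_take_succ s m (by omega)
  rw [List.take_of_length_le hm.le, h3, show s.length.choose 2 = (m + 1).choose 2 by rw [hm],
    add_choose_two] at h4
  simp only [hm, Nat.add_sub_cancel] at h1
  simp at h4
  omega

theorem IsLandau.lt_length {s : List ℕ} (hs : IsLandau s) {x : ℕ} (hx : x ∈ s) :
    x < s.length := by
  obtain ⟨i, hi, rfl⟩ := List.mem_iff_getElem.mp hx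
  exact hs.getElem_lt hi

theorem IsLandau.dsum {u v : List ℕ} (hu : IsLandau u) (hv : IsLandau v) :
    IsLandau (dsum u v) := by
  refine ⟨?_, fun k hk => ?_, ?_⟩
  · refine List.pairwise_append.mpr ⟨hu.sorted, hv.sorted.map _ (fun a b h => by omega), ?_⟩
    intro a ha b hb
    obtain ⟨c, -, rfl⟩ := List.mem_map.mp hb
    have := hu.lt_length ha
    omega
  · rcases le_total k u.length with h | h
    · rw [take_dsum _ h]
      exact hu.le_sum k h
    · obtain ⟨j, rfl⟩ := Nat.exists_eq_add_of_le h
      rw [length_dsum] at hk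
      have hj : j ≤ v.length := by omega
      rw [sum_take_dsum u hj, add_choose_two, hu.sum_eq]
      have := hv.le_sum j hj
      omega
  · rw [sum_dsum, length_dsum, add_choose_two, hu.sum_eq, hv.sum_eq]

theorem IsLandau.of_dsum {u v : List ℕ} (h : IsLandau (ScoreSeq.dsum u v))
    (hu : u.sum = u.length.choose 2) : IsLandau u ∧ IsLandau v := by
  obtain ⟨h1, h2, -⟩ := List.pairwise_append.mp h.sorted
  refine ⟨⟨h1, fun k hk => ?_, hu⟩, List.pairwise_map.mp h2 |>.imp fun h => by omega,
    fun k hk => ?_, ?_⟩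
  · have := h.le_sum k (by rw [length_dsum]; omega)
    rwa [take_dsum _ hk] at this
  · have := h.le_sum (u.length + k) (by rw [length_dsum]; omega)
    rw [sum_take_dsum u hk, add_choose_two, hu] at this
    omega
  · have := h.sum_eq
    rw [sum_dsum, length_dsum, add_choose_two, hu] at this
    omega

/-- A list with Landau's conditions splits at each position where equality holds. -/
theorem IsLandau.exists_eq_dsum {s : List ℕ} (hs : IsLandau s) {k : ℕ} (hk : k ≤ s.length)
    (h : (s.take k).sum = k.choose 2) :
    ∃ u v, IsLandau u ∧ IsLandau v ∧ u.length = k ∧ s = ScoreSeq.dsum u v := by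
  have hl : (s.take k).length = k := by simp [hk]
  have hge : ∀ x ∈ s.drop k, k ≤ x := by
    intro x hx
    obtain ⟨i, hi, rfl⟩ := List.mem_iff_getElem.mp hx
    rw [List.length_drop] at hi
    rw [List.getElem_drop]
    -- The entry at position `k` is at least `(k + 1).choose 2 - k.choose 2 = k`.
    have h1 := hs.le_sum (k + 1) (by omega)
    have h2 := getD_mono hs.sorted (i := k) (j := k + i) (by omega) (by omega)
    rw [List.sum_take_succ s k (by omega), h, add_choose_two] at h1
    rw [List.getD_eq_getElem _ _ (by omega), List.getD_eq_getElem _ _ (by omega)] at h2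
    simp at h1
    omega
  have hd : s = ScoreSeq.dsum (s.take k) ((s.drop k).map (· - k)) := by
    conv_lhs => rw [← List.take_append_drop k s]
    rw [ScoreSeq.dsum, List.map_map, hl]
    congr 1
    conv_lhs => rw [← List.map_id (s.drop k)]
    refine List.map_congr_left fun x hx => ?_
    have := hge x hx
    simp only [Function.comp_apply, id_eq]
    omega
  have := IsLandau.of_dsum (hd ▸ hs) (by rw [h, hl])
  exact ⟨_, _, this.1, this.2, hl, hd⟩

/-- Splitting at the last proper position where equality holds in Landau's conditions leaves a strong
list on the right. -/
theorem IsLandau.exists_last_summand {s : List ℕ} (hs : IsLandau s) (h0 : s ≠ []) :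
    ∃ u t, IsLandau u ∧ IsStrongLandau t ∧ s = ScoreSeq.dsum u t := by
  have hpos := List.length_pos_iff.mpr h0
  let P : ℕ → Prop := fun k => (s.take k).sum = k.choose 2
  let k := Nat.findGreatest P (s.length - 1)
  have hk : k ≤ s.length - 1 := Nat.findGreatest_le _
  have hPk : P k := Nat.findGreatest_spec (P := P) (Nat.zero_le _) (by simp [P])
  obtain ⟨u, v, hu, hv, hl, rfl⟩ := hs.exists_eq_dsum (by omega) hPk
  rw [length_dsum] at hk hpos
  refine ⟨u, v, hu, ⟨hv, ?_, fun j hj hjv => ?_⟩, rfl⟩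
  · rintro rfl
    simp at hk hpos
    omega
  · refine lt_of_le_of_ne (hv.le_sum j hjv.le) fun he => ?_
    refine Nat.findGreatest_is_greatest (P := P) (n := (ScoreSeq.dsum u v).length - 1)
      (k := u.length + j) (by change k < _; omega) (by rw [length_dsum]; omega) ?_
    change (List.take _ _).sum = _
    rw [sum_take_dsum u hjv.le, add_choose_two, hu.sum_eq, he]

theorem dsumList_concat (ts : List (List ℕ)) (t : List ℕ) :
    dsumList (ts ++ [t]) = dsum (dsumList ts) t := by
  induction ts with
  | nil => simp [dsumList, dsum]
  | cons a ts ih =>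
    change dsum a (dsumList (ts ++ [t])) = dsum (dsum a (dsumList ts)) t
    rw [ih, dsum_assoc]

theorem isLandau_nil : IsLandau [] := ⟨List.Pairwise.nil, by simp, by simp⟩

theorem IsLandau.exists_decomposition {s : List ℕ} (hs : IsLandau s) :
    ∃ ts, IsStrongDecomposition s ts := by
  induction hn : s.length using Nat.strong_induction_on generalizing s with
  | _ n ih =>
    by_cases h0 : s = []
    · exact ⟨[], by simp, by simp [h0, dsumList]⟩
    · obtain ⟨u, t, hu, ht, rfl⟩ := hs.exists_last_summand h0
      have := List.length_pos_iff.mpr ht.ne_nil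
      rw [length_dsum] at hn
      obtain ⟨ts, h1, h2⟩ := ih u.length (by omega) hu rfl
      refine ⟨ts ++ [t], ?_, by rw [dsumList_concat, ← h2]⟩
      intro x hx
      rcases List.mem_append.mp hx with hx | hx
      · exact h1 x hx
      · rw [List.mem_singleton.mp hx]
        exact mem_strongSeqs.mpr ⟨ht, rfl⟩

theorem isLandau_dsumList {ts : List (List ℕ)} (h : ∀ t ∈ ts, t ∈ strongSeqs t.length) :
    IsLandau (dsumList ts) := by
  induction ts with
  | nil => exact isLandau_nil
  | cons a ts ih =>
    exact (mem_strongSeqs.mp (h a (by simp))).1.toIsLandau.dsum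
      (ih fun t ht => h t (List.mem_cons_of_mem _ ht))

theorem mem_lastSet_iff_dsum {n : ℕ} {s : List ℕ} {i : ℕ} :
    (s, i) ∈ lastSet n ↔ (s.length = n ∧ i < n) ∧
      ∃ u t, IsLandau u ∧ IsStrongLandau t ∧ s = dsum u t ∧ u.length ≤ i := by
  constructor
  · rintro ⟨⟨hs, hi⟩, ts, hne, ⟨h1, h2⟩, h3⟩
    refine ⟨⟨(mem_scoreSeqs.mp hs).2, hi⟩, dsumList ts.dropLast, ts.getLast hne,
      isLandau_dsumList fun t ht => h1 t (List.mem_of_mem_dropLast ht),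
      (mem_strongSeqs.mp (h1 _ (List.getLast_mem hne))).1, ?_⟩
    have hd : s = dsum (dsumList ts.dropLast) (ts.getLast hne) := by
      rw [← dsumList_concat, List.dropLast_append_getLast]
      exact h2
    refine ⟨hd, ?_⟩
    have hl := (mem_scoreSeqs.mp hs).2
    simp only at hl h3
    rw [hd, length_dsum] at hl
    omega
  · rintro ⟨⟨hl, hi⟩, u, t, hu, ht, rfl, hui⟩
    refine ⟨⟨mem_scoreSeqs.mpr ⟨hu.dsum ht.toIsLandau, hl⟩, hi⟩, ?_⟩
    obtain ⟨ts, h1, h2⟩ := hu.exists_decomposition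
    refine ⟨ts ++ [t], by simp, ⟨?_, by simp only [dsumList_concat, ← h2]⟩, ?_⟩
    · intro x hx
      rcases List.mem_append.mp hx with hx | hx
      · exact h1 x hx
      · rw [List.mem_singleton.mp hx]
        exact mem_strongSeqs.mpr ⟨ht, rfl⟩
    · rw [length_dsum] at hl
      simp only [List.getLast_append_singleton]
      omega

/-- Pointing into the last strong summand means that Landau's inequality is strict at all proper
positions beyond the distinguished one. -/
theorem mem_lastSet_iff {n : ℕ} {s : List ℕ} {i : ℕ} :
    (s, i) ∈ lastSet n ↔ (s.length = n ∧ i < n) ∧ IsLandau s ∧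
      ∀ k, i < k → k < n → k.choose 2 < (s.take k).sum := by
  rw [mem_lastSet_iff_dsum]
  refine and_congr_right fun ⟨hl, hi⟩ => ?_
  constructor
  · rintro ⟨u, t, hu, ht, rfl, hui⟩
    refine ⟨hu.dsum ht.toIsLandau, fun k hik hkn => ?_⟩
    rw [length_dsum] at hl
    obtain ⟨j, rfl⟩ := Nat.exists_eq_add_of_le (hui.trans hik.le)
    rw [sum_take_dsum u (by omega), add_choose_two, hu.sum_eq]
    have := ht.lt_sum j (by omega) (by omega)
    omega
  · rintro ⟨hs, h⟩
    obtain ⟨u, t, hu, ht, rfl⟩ := hs.exists_last_summand (by rintro rfl; simp at hl; omega)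
    refine ⟨u, t, hu, ht, rfl, ?_⟩
    by_contra! hlt
    have := List.length_pos_iff.mpr ht.ne_nil
    rw [length_dsum] at hl
    have := h _ hlt (by omega)
    rw [take_dsum _ le_rfl, List.take_length, hu.sum_eq] at this
    exact this.false

/-! ### Periodic lifts of multisets over `ℤ/nℤ` -/

/-- The sum over a full period does not depend on where the period starts. -/
theorem sum_window {α : Type*} [AddCancelCommMonoid α] {n : ℕ} {f : ℕ → α}
    (hf : ∀ k, f (k + n) = f k) (q : ℕ) : ∑ j ∈ range n, f (j + q) = ∑ j ∈ range n, f j := by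
  induction q with
  | zero => rfl
  | succ q ih =>
    rw [← ih]
    have h1 := sum_range_succ (fun j => f (j + q)) n
    have h2 := sum_range_succ' (fun j => f (j + q)) n
    simp only [zero_add, add_comm n q, hf] at h1 h2
    rw [h1] at h2
    rw [add_right_cancel h2]
    refine sum_congr rfl fun j _ => ?_
    rw [add_assoc, add_comm q 1]

theorem map_window {β : Type*} {n : ℕ} {f : ℕ → β} (hf : ∀ k, f (k + n) = f k) (q : ℕ) :
    (range n).val.map (fun j => f (j + q)) = (range n).val.map f := by
  have h : ∀ g : ℕ → β, (range n).val.map g = ∑ j ∈ range n, {g j} := fun g => by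
    rw [Finset.sum, ← Multiset.sum_map_singleton ((range n).val.map g), Multiset.map_map]
    rfl
  rw [h, h]
  exact sum_window (f := fun k => ({f k} : Multiset β)) (fun k => by simp only [hf]) q

/-- A normalized lift of a multiset `M` over `ℤ/nℤ`: a nondecreasing integer sequence `A` with
`A (k + n) = A k + n` whose residues over a period form `M`. All the integers with residues in `M` can
be enumerated in this way, and the indexing is fixed by the normalization
`∑ k < n, (A k - k) = 0`. -/
structure IsLift (n : ℕ) (M : Multiset (ZMod n)) (A : ℕ → ℤ) : Prop where
  mono : Monotone A
  add_period : ∀ k, A (k + n) = A k + n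
  residues : (range n).val.map (fun k => (A k : ZMod n)) = M
  sum_eq : ∑ k ∈ range n, (A k - k) = 0

/-- The extension of a list of length `n` to a sequence with `A (k + n) = A k + n`. -/
def extend (n : ℕ) (s : List ℕ) (k : ℕ) : ℤ := (s.getD (k % n) 0 : ℕ) + n * (k / n : ℕ)

section extend

variable {n : ℕ} {s : List ℕ}

theorem extend_of_lt {k : ℕ} (hk : k < n) : extend n s k = (s.getD k 0 : ℕ) := by
  simp [extend, Nat.mod_eq_of_lt hk, Nat.div_eq_of_lt hk]

theorem extend_add (hn : 0 < n) (k : ℕ) : extend n s (k + n) = extend n s k + n := by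
  rw [extend, extend, Nat.add_mod_right, Nat.add_div_right _ hn]
  push_cast
  ring

theorem extend_mono (hn : 0 < n) (hl : s.length = n) (hs : s.Pairwise (· ≤ ·))
    (hlt : ∀ x ∈ s, x < n) : Monotone (extend n s) := by
  have hlt' : ∀ j, s.getD j 0 < n := by
    intro j
    by_cases hj : j < s.length
    · rw [List.getD_eq_getElem _ _ hj]
      exact hlt _ (List.getElem_mem hj)
    · rw [List.getD_eq_default _ _ (by omega)]
      exact hn
  refine monotone_nat_of_le_succ fun k => ?_
  have hm := Nat.mod_lt k hn
  have hk := Nat.mod_add_div k n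
  rcases Nat.lt_or_ge (k % n + 1) n with h | h
  · have h1 : (k + 1) % n = k % n + 1 := by
      conv_lhs => rw [← hk, add_right_comm, Nat.add_mul_mod_self_left, Nat.mod_eq_of_lt h]
    have h2 : (k + 1) / n = k / n := by
      conv_lhs => rw [← hk, add_right_comm, Nat.add_mul_div_left _ _ hn, Nat.div_eq_of_lt h]
      omega
    rw [extend, extend, h1, h2]
    have := getD_mono hs (Nat.le_succ (k % n)) (hl ▸ h)
    simp only [Nat.succ_eq_add_one] at this
    omega
  · have h0 : k + 1 = 0 + n * (k / n + 1) := by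
      rw [Nat.mul_add, mul_one]
      omega
    have h1 : (k + 1) % n = 0 := by rw [h0, Nat.add_mul_mod_self_left, Nat.zero_mod]
    have h2 : (k + 1) / n = k / n + 1 := by
      conv_lhs => rw [h0, Nat.add_mul_div_left _ _ hn, Nat.zero_div]
      omega
    rw [extend, extend, h1, h2]
    have := hlt' (k % n)
    push_cast
    rw [mul_add, mul_one]
    omega

theorem map_extend {β : Type*} (hl : s.length = n) (g : ℤ → β) :
    (range n).val.map (fun k => g (extend n s k)) = (s : Multiset ℕ).map fun a : ℕ => g a := by
  have h : s = (List.range n).map fun k => s.getD k 0 := by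
    refine List.ext_getElem (by simp [hl]) fun i h1 h2 => ?_
    simp [h1]
  conv_rhs => rw [h, ← Multiset.map_coe, Multiset.map_map]
  refine Multiset.map_congr rfl fun k hk => ?_
  rw [extend_of_lt (by simpa using hk)]
  rfl

end extend

theorem choose_two_eq_sum (k : ℕ) : k.choose 2 = ∑ j ∈ range k, j := by
  rw [Nat.choose_two_right, sum_range_id]

theorem sum_extend {n : ℕ} {s : List ℕ} (hl : s.length = n) :
    ∑ k ∈ range n, (extend n s k - k) = (s.sum : ℤ) - (n.choose 2 : ℕ) := by
  rw [← List.take_length (l := s), sum_take_eq_sum_range s le_rfl, List.take_length, hl,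
    choose_two_eq_sum, sum_sub_distrib]
  push_cast
  congr 1
  exact sum_congr rfl fun k hk => extend_of_lt (mem_range.mp hk)

section IsLift

variable {n : ℕ} {M : Multiset (ZMod n)} {A B : ℕ → ℤ}

theorem add_mul_period (h : ∀ k, A (k + n) = A k + n) (k m : ℕ) :
    A (k + n * m) = A k + n * m := by
  induction m with
  | zero => simp
  | succ m ih =>
    rw [Nat.mul_succ, ← add_assoc, h, ih]
    push_cast
    ring

theorem IsLift.periodic_residue (h : IsLift n M A) (k : ℕ) :
    ((A (k + n) : ℤ) : ZMod n) = (A k : ZMod n) := by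
  rw [h.add_period]
  simp

theorem IsLift.periodic_sub (h : IsLift n M A) (k : ℕ) :
    A (k + n) - (k + n : ℕ) = A k - k := by
  rw [h.add_period]
  push_cast
  ring

/-- Some period of `A` takes its values in the interval `[x, x + n)`. -/
theorem IsLift.exists_window (h : IsLift n M A) (hn : 0 < n) {x : ℤ} (hx : A 0 < x) :
    ∃ q, ∀ j < n, x ≤ A (j + q) ∧ A (j + q) < x + n := by
  have hex : ∃ q, x ≤ A q := by
    refine ⟨0 + n * (x - A 0).toNat, ?_⟩
    rw [add_mul_period h.add_period]
    have h1 : (1 : ℤ) ≤ n := by exact_mod_cast hn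
    have h2 : (((x - A 0).toNat : ℕ) : ℤ) = x - A 0 := Int.toNat_of_nonneg (by omega)
    rw [h2]
    nlinarith
  classical
  refine ⟨Nat.find hex, fun j hj => ⟨(Nat.find_spec hex).trans (h.mono (Nat.le_add_left _ _)), ?_⟩⟩
  have hq : Nat.find hex ≠ 0 := fun h0 => by
    have := Nat.find_spec hex
    rw [h0] at this
    omega
  have h1 := Nat.find_min hex (m := Nat.find hex - 1) (by omega)
  have h2 := h.add_period (Nat.find hex - 1)
  have h3 := h.mono (show j + Nat.find hex ≤ Nat.find hex - 1 + n by omega)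
  omega

theorem map_window_eq [NeZero n] (h : IsLift n M A) {c : ℤ} {q : ℕ}
    (hq : ∀ j < n, n * c ≤ A (j + q) ∧ A (j + q) < n * c + n) :
    (range n).val.map (fun j => A (j + q)) = M.map fun z => (z.val : ℤ) + n * c := by
  rw [← h.residues, ← map_window (f := fun k => (A k : ZMod n)) h.periodic_residue q,
    Multiset.map_map]
  refine Multiset.map_congr rfl fun j hj => ?_
  have hj' := hq j (by simpa using hj)
  rw [Function.comp_apply, ZMod.val_intCast]
  have h1 : A (j + q) % n = A (j + q) - n * c := by
    rw [← Int.sub_mul_emod_self_left (A (j + q)) n c]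
    exact Int.emod_eq_of_lt (by omega) (by omega)
  omega

/-- A multiset over `ℤ/nℤ` has at most one normalized lift: the periods of two lifts with values in the
same interval `[n * c, n * c + n)` agree, and the normalization forces them to start at the same
index. -/
theorem IsLift.unique (hn : 0 < n) (hA : IsLift n M A) (hB : IsLift n M B) : A = B := by
  have : NeZero n := ⟨hn.ne'⟩
  obtain ⟨c, hcA, hcB⟩ : ∃ c : ℤ, A 0 < n * c ∧ B 0 < n * c := by
    have h1 : (1 : ℤ) ≤ n := by exact_mod_cast hn
    refine ⟨|A 0| + |B 0| + 1, ?_, ?_⟩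
    · nlinarith [le_abs_self (A 0), abs_nonneg (A 0), abs_nonneg (B 0)]
    · nlinarith [le_abs_self (B 0), abs_nonneg (A 0), abs_nonneg (B 0)]
  obtain ⟨q, hq⟩ := hA.exists_window hn hcA
  obtain ⟨r, hr⟩ := hB.exists_window hn hcB
  have hsorted : ∀ (C : ℕ → ℤ) (_ : Monotone C) (t : ℕ),
      ((List.range n).map fun j => C (j + t)).Pairwise (· ≤ ·) := fun C hC t =>
    List.pairwise_map.mpr (List.pairwise_lt_range.imp fun h => hC (by omega))
  have hlist : (List.range n).map (fun j => A (j + q)) = (List.range n).map fun j => B (j + r) := by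
    refine List.Perm.eq_of_pairwise' (hsorted A hA.mono q) (hsorted B hB.mono r) ?_
    rw [← Multiset.coe_eq_coe, ← Multiset.map_coe, ← Multiset.map_coe]
    exact (map_window_eq hA hq).trans (map_window_eq hB hr).symm
  have heq : ∀ j < n, A (j + q) = B (j + r) := fun j hj =>
    List.map_inj_left.mp hlist j (List.mem_range.mpr hj)
  have hqr : q = r := by
    have h1 := (sum_window (f := fun k => A k - k) hA.periodic_sub q).trans hA.sum_eq
    have h2 := (sum_window (f := fun k => B k - k) hB.periodic_sub r).trans hB.sum_eq
    have h3 : ∑ j ∈ range n, (A (j + q) - (j + q : ℕ)) =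
        ∑ j ∈ range n, (B (j + r) - (j + r : ℕ)) + n * ((r : ℤ) - q) := by
      rw [← nsmul_eq_mul, ← card_range n, ← sum_const, card_range, ← sum_add_distrib]
      refine sum_congr rfl fun j hj => ?_
      rw [heq j (mem_range.mp hj)]
      push_cast
      ring
    rw [h1, h2, zero_add, eq_comm, mul_eq_zero] at h3
    omega
  subst hqr
  funext k
  have hle : q ≤ k + n * q := (Nat.le_mul_of_pos_left q hn).trans (Nat.le_add_left _ _)
  have hk : k + n * q = (k + n * q - q) % n + q + n * ((k + n * q - q) / n) := by
    have := Nat.mod_add_div (k + n * q - q) n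
    omega
  have h1 := add_mul_period hA.add_period k q
  have h2 := add_mul_period hB.add_period k q
  rw [hk, add_mul_period hA.add_period] at h1
  rw [hk, add_mul_period hB.add_period, ← heq _ (Nat.mod_lt _ hn)] at h2
  omega

/-- The lift exists since the condition on the sum of `M` says that the normalization sum of any lift
is divisible by `n`, the amount by which it changes when the index is shifted by one. -/
theorem exists_isLift (hn : 0 < n) (hM : M ∈ egz n) : ∃ A, IsLift n M A := by
  have : NeZero n := ⟨hn.ne'⟩
  let s := (M.map ZMod.val).sort (· ≤ ·)
  have hsM : (s : Multiset ℕ) = M.map ZMod.val := Multiset.sort_eq _ _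
  have hl : s.length = n := by simpa [s] using hM.1
  have hlt : ∀ x ∈ s, x < n := by
    intro x hx
    rw [← Multiset.mem_coe, hsM] at hx
    obtain ⟨z, -, rfl⟩ := Multiset.mem_map.mp hx
    exact z.val_lt
  have hmono := extend_mono hn hl (Multiset.pairwise_sort _ _) hlt
  have hadd := extend_add (s := s) hn
  have hcast : (s : Multiset ℕ).map (fun a : ℕ => ((a : ℤ) : ZMod n)) = M := by
    rw [hsM, Multiset.map_map]
    simp
  have hdvd : (n : ℤ) ∣ (s.sum : ℤ) - (n.choose 2 : ℕ) := by
    rw [← ZMod.intCast_zmod_eq_zero_iff_dvd]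
    have h1 : ((s.sum : ℕ) : ZMod n) = M.sum := by
      conv_rhs => rw [← hcast]
      rw [← Multiset.sum_coe, ← Nat.coe_castAddMonoidHom, map_multiset_sum]
      simp
    rw [Int.cast_sub, Int.cast_natCast, Int.cast_natCast, h1, hM.2, sub_self]
  obtain ⟨c, hc⟩ := hdvd
  have hq : 0 ≤ n * |c| - c := by
    have h1 : (1 : ℤ) ≤ n := by exact_mod_cast hn
    nlinarith [le_abs_self c, abs_nonneg c]
  -- Shifting the index by `q` adds `n * q`, lowering all values by `n * |c|` subtracts `n * n * |c|`.
  let q : ℕ := (n * |c| - c).toNat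
  have hq' : (q : ℤ) = n * |c| - c := Int.toNat_of_nonneg hq
  refine ⟨fun k => extend n s (k + q) - n * |c|, fun a b hab => ?_, fun k => ?_, ?_, ?_⟩
  · exact sub_le_sub_right (hmono (by omega)) _
  · rw [add_right_comm, hadd]
    ring
  · rw [← hcast, ← map_extend hl fun x => (x : ZMod n),
      ← map_window (f := fun k => ((extend n s k : ℤ) : ZMod n)) (fun k => by simp [hadd]) q]
    refine Multiset.map_congr rfl fun k _ => ?_
    simp
  · have h1 := sum_window (f := fun k => extend n s k - k)
      (fun k => by rw [hadd]; push_cast; ring) q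
    rw [sum_extend hl, hc] at h1
    have h2 : ∑ k ∈ range n, (extend n s (k + q) - n * |c| - k) =
        ∑ k ∈ range n, (extend n s (k + q) - (k + q : ℕ)) + n * (q - n * |c|) := by
      have h3 : n * ((q : ℤ) - n * |c|) = ∑ _j ∈ range n, ((q : ℤ) - n * |c|) := by
        rw [sum_const, card_range, nsmul_eq_mul]
      rw [h3, ← sum_add_distrib]
      refine sum_congr rfl fun j hj => ?_
      push_cast
      ring
    rw [h2, h1, hq']
    ring

end IsLift

/-- The sum of the first `m` terms of `A k - k`. -/
def excess (A : ℕ → ℤ) (m : ℕ) : ℤ := ∑ k ∈ range m, (A k - k)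

/-- The index `p` is the first positive index at which `excess A` takes its minimum. -/
structure IsFirstArgmin (A : ℕ → ℤ) (p : ℕ) : Prop where
  pos : 0 < p
  le : ∀ m, excess A p ≤ excess A m
  lt : ∀ m, 0 < m → m < p → excess A p < excess A m

theorem IsFirstArgmin.unique {A : ℕ → ℤ} {p q : ℕ} (hp : IsFirstArgmin A p)
    (hq : IsFirstArgmin A q) : p = q := by
  rcases lt_trichotomy p q with h | h | h
  · exact absurd (hp.le q) (hq.lt p hp.pos h).not_ge
  · exact h
  · exact absurd (hq.le p) (hp.lt q hq.pos h).not_ge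

theorem IsLift.excess_add {n : ℕ} {M : Multiset (ZMod n)} {A : ℕ → ℤ} (h : IsLift n M A) (m : ℕ) :
    excess A (m + n) = excess A m := by
  have := (sum_window (f := fun k => A k - k) h.periodic_sub m).trans h.sum_eq
  rw [excess, sum_range_add]
  simp only [add_comm m]
  rw [this, add_zero]
  rfl

theorem IsLift.exists_isFirstArgmin {n : ℕ} {M : Multiset (ZMod n)} {A : ℕ → ℤ} (h : IsLift n M A)
    (hn : 0 < n) : ∃ p ≤ n, IsFirstArgmin A p := by
  classical
  have hmod : ∀ m, excess A m = excess A (m % n) := fun m => by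
    have : ∀ k, excess A (m % n + n * k) = excess A (m % n) := fun k => by
      induction k with
      | zero => simp
      | succ k ih => rw [Nat.mul_succ, ← add_assoc, h.excess_add, ih]
    rw [← this (m / n), Nat.mod_add_div]
  have hex : ∃ p, 0 < p ∧ ∀ m, excess A p ≤ excess A m := by
    obtain ⟨p, -, hp⟩ := (range n).exists_min_image (excess A) ⟨0, mem_range.mpr hn⟩
    refine ⟨p + n, by omega, fun m => ?_⟩
    rw [h.excess_add, hmod m]
    exact hp _ (mem_range.mpr (Nat.mod_lt _ hn))
  have hspec := Nat.find_spec hex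
  refine ⟨Nat.find hex, ?_, hspec.1, hspec.2, fun m hm hlt => ?_⟩
  · by_contra! hlt
    refine Nat.find_min hex (m := Nat.find hex - n) (by omega) ⟨by omega, ?_⟩
    rw [← h.excess_add, Nat.sub_add_cancel hlt.le]
    exact hspec.2
  · have := Nat.find_min hex hlt
    push Not at this
    obtain ⟨k, hk⟩ := this hm
    exact (hspec.2 k).trans_lt hk

/-- If `s` is the period of `A` starting at `p`, lowered by `p`, then the slack in Landau's
inequalities for `s` is the growth of `excess A` after `p`. -/
theorem sum_take_sub_choose {n p : ℕ} {A : ℕ → ℤ} {s : List ℕ} (hl : s.length = n)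
    (hs : ∀ k < n, ((s.getD k 0 : ℕ) : ℤ) = A (k + p) - p) {k : ℕ} (hk : k ≤ n) :
    ((s.take k).sum : ℤ) - (k.choose 2 : ℕ) = excess A (p + k) - excess A p := by
  rw [sum_take_eq_sum_range s (hl ▸ hk), choose_two_eq_sum, excess, excess, sum_range_add]
  push_cast
  rw [← sum_sub_distrib, add_sub_cancel_left]
  refine sum_congr rfl fun j hj => ?_
  rw [hs j (by have := mem_range.mp hj; omega), add_comm p j]
  ring

/-- Cycle lemma: the period starting at `p`, pointed at `n - p`, belongs to `L_n` exactly if `p` is the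
first positive index minimizing `excess A`. Landau's inequalities say that `p` is a minimizer, and
strictness beyond the position `n - p` says that there is none in `(0, p)`. -/
theorem mem_lastSet_iff_isFirstArgmin {n : ℕ} {M : Multiset (ZMod n)} {A : ℕ → ℤ}
    (h : IsLift n M A) {s : List ℕ} {i p : ℕ} (hip : i + p = n) (hl : s.length = n) (hin : i < n)
    (hs : ∀ k < n, ((s.getD k 0 : ℕ) : ℤ) = A (k + p) - p) :
    (s, i) ∈ lastSet n ↔ IsFirstArgmin A p := by
  have hn : 0 < n := by omega
  have hsum := fun {k} => sum_take_sub_choose (k := k) hl hs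
  rw [mem_lastSet_iff]
  constructor
  · rintro ⟨-, hL, hlt⟩
    have hle : ∀ k ≤ n, excess A p ≤ excess A (p + k) := fun k hk => by
      have h1 := hL.le_sum k (hl ▸ hk)
      have h2 := hsum hk
      omega
    have hle' : ∀ m < n, excess A p ≤ excess A m := fun m hm => by
      rcases Nat.le_total p m with hpm | hpm
      · have := hle (m - p) (by omega)
        rwa [Nat.add_sub_cancel' hpm] at this
      · have := hle (m + n - p) (by omega)
        rwa [Nat.add_sub_cancel' (by omega), h.excess_add] at this
    refine ⟨by omega, fun m => ?_, fun m hm hmp => ?_⟩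
    · induction m using Nat.strong_induction_on with
      | _ m ih =>
        rcases Nat.lt_or_ge m n with hm | hm
        · exact hle' m hm
        · have := ih (m - n) (by omega)
          rwa [← h.excess_add (m - n), Nat.sub_add_cancel hm] at this
    · have h1 := hlt (m + n - p) (by omega) (by omega)
      have h2 := hsum (k := m + n - p) (by omega)
      rw [Nat.add_sub_cancel' (by omega), h.excess_add] at h2
      omega
  · intro hp
    refine ⟨⟨hl, hin⟩, ⟨?_, fun k hk => ?_, ?_⟩, fun k hik hkn => ?_⟩
    · refine List.pairwise_iff_getElem.mpr fun a b ha hb hab => ?_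
      have h1 := hs a (hl ▸ ha)
      have h2 := hs b (hl ▸ hb)
      rw [List.getD_eq_getElem _ _ ha] at h1
      rw [List.getD_eq_getElem _ _ hb] at h2
      have h3 := h.mono (show a + p ≤ b + p by omega)
      omega
    · have h1 := hsum (hl ▸ hk)
      have h2 := hp.le (p + k)
      omega
    · have h1 := hsum le_rfl
      rw [h.excess_add, List.take_of_length_le hl.le] at h1
      rw [hl]
      omega
    · have h1 := hsum hkn.le
      have h2 := hp.lt (p + k - n) (by omega) (by omega)
      rw [← h.excess_add (p + k - n), Nat.sub_add_cancel (by omega)] at h2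
      omega

theorem mu_eq (n : ℕ) (s : List ℕ) (j : ℤ) :
    mu n s j = (s : Multiset ℕ).map fun a : ℕ => (a : ZMod n) + (j : ZMod n) := by
  -- In the definition of `mu`, the coercion to `ZMod n` is performed by `Multiset.bind`.
  simp only [mu, Multiset.bind_def, Multiset.pure_def, Multiset.bind_singleton, Multiset.map_map]
  rfl

section bijection

variable {n : ℕ} {s : List ℕ} {i : ℕ}

theorem isLandau_of_mem_lastSet (h : (s, i) ∈ lastSet n) :
    IsLandau s ∧ s.length = n ∧ i < n := by
  have := mem_lastSet_iff.mp h
  exact ⟨this.2.1, this.1⟩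

/-- The normalized lift of `μ(s - i)`. -/
theorem isLift_mu (h : (s, i) ∈ lastSet n) :
    IsLift n (mu n s (-(i : ℤ))) fun k => extend n s (k + i) - i := by
  obtain ⟨hL, hl, hi⟩ := isLandau_of_mem_lastSet h
  have hn : 0 < n := by omega
  have hadd := extend_add (s := s) hn
  have hmono := extend_mono hn hl hL.sorted fun x hx => hl ▸ hL.lt_length hx
  refine ⟨fun a b hab => sub_le_sub_right (hmono (by omega)) _, fun k => ?_, ?_, ?_⟩
  · rw [add_right_comm, hadd]
    ring
  · rw [map_window (f := fun k => ((extend n s k - i : ℤ) : ZMod n)) (fun k => by simp [hadd]) i,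
      map_extend hl fun x => ((x - i : ℤ) : ZMod n), mu_eq]
    refine Multiset.map_congr rfl fun a _ => ?_
    push_cast
    ring
  · have h1 := sum_window (f := fun k => extend n s k - k)
      (fun k => by rw [hadd]; push_cast; ring) i
    rw [sum_extend hl, hL.sum_eq, hl, sub_self] at h1
    rw [← h1]
    refine sum_congr rfl fun k _ => ?_
    push_cast
    ring

theorem getD_eq_extend (hi : i < n) {k : ℕ} (hk : k < n) :
    ((s.getD k 0 : ℕ) : ℤ) = extend n s (k + (n - i) + i) - i - (n - i : ℕ) := by
  rw [add_assoc, Nat.sub_add_cancel hi.le, extend_add (by omega), extend_of_lt hk]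
  push_cast [hi.le]
  ring

theorem mu_mem_egz (h : (s, i) ∈ lastSet n) : mu n s (-(i : ℤ)) ∈ egz n := by
  obtain ⟨hL, hl, hi⟩ := isLandau_of_mem_lastSet h
  refine ⟨by simp [mu_eq, hl], ?_⟩
  have h1 : ((s : Multiset ℕ).map fun a : ℕ => (a : ZMod n)).sum = ((s.sum : ℕ) : ZMod n) := by
    rw [← Multiset.sum_coe, ← Nat.coe_castAddMonoidHom, map_multiset_sum]
  rw [mu_eq, Multiset.sum_map_add, h1, hL.sum_eq, hl]
  simp [hl]

theorem bijOn_mu (hn : 1 ≤ n) :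
    Set.BijOn (fun p : List ℕ × ℕ => mu n p.1 (-(p.2 : ℤ))) (lastSet n) (egz n) := by
  refine ⟨fun ⟨s, i⟩ h => mu_mem_egz h, ?_, ?_⟩
  · rintro ⟨s, i⟩ h ⟨t, j⟩ h' heq
    change mu n s _ = mu n t _ at heq
    obtain ⟨-, hl, hi⟩ := isLandau_of_mem_lastSet h
    obtain ⟨-, hl', hj⟩ := isLandau_of_mem_lastSet h'
    have hA := isLift_mu h
    have hB := isLift_mu h'
    rw [← heq] at hB
    have hAB := hA.unique hn hB
    have hp := (mem_lastSet_iff_isFirstArgmin hA (p := n - i) (by omega) hl hi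
      fun k hk => getD_eq_extend hi hk).mp h
    have hq := (mem_lastSet_iff_isFirstArgmin hB (p := n - j) (by omega) hl' hj
      fun k hk => getD_eq_extend hj hk).mp h'
    rw [hAB] at hp
    have hij : i = j := by
      have := hp.unique hq
      omega
    subst hij
    refine Prod.ext (List.ext_getElem (hl.trans hl'.symm) fun k h1 h2 => ?_) rfl
    have e1 := getD_eq_extend (s := s) hi (hl ▸ h1)
    have e2 := getD_eq_extend (s := t) hi (hl' ▸ h2)
    have e3 := congrFun hAB (k + (n - i))
    rw [List.getD_eq_getElem _ _ h1] at e1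
    rw [List.getD_eq_getElem _ _ h2] at e2
    change extend n s _ - _ = extend n t _ - _ at e3
    omega
  · intro M hM
    obtain ⟨A, hA⟩ := exists_isLift hn hM
    obtain ⟨p, hpn, hp⟩ := hA.exists_isFirstArgmin hn
    have hnonneg : ∀ k, 0 ≤ A (k + p) - p := fun k => by
      have h1 := hp.le (p + 1)
      rw [excess, excess, sum_range_succ] at h1
      have h2 := hA.mono (Nat.le_add_left p k)
      omega
    let s := (List.range n).map fun k => (A (k + p) - p).toNat
    have hl : s.length = n := by simp [s]
    have hs : ∀ k < n, ((s.getD k 0 : ℕ) : ℤ) = A (k + p) - p := fun k hk => by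
      rw [List.getD_eq_getElem _ _ (hl.symm ▸ hk)]
      have h1 := Int.toNat_of_nonneg (hnonneg k)
      simpa only [s, List.getElem_map, List.getElem_range] using h1
    have hpos := hp.pos
    refine ⟨(s, n - p), (mem_lastSet_iff_isFirstArgmin hA (Nat.sub_add_cancel hpn) hl
      (by omega) hs).mpr hp, ?_⟩
    change mu n s _ = M
    rw [mu_eq]
    conv_rhs => rw [← hA.residues, ← map_window (f := fun k => (A k : ZMod n)) hA.periodic_residue p]
    rw [← Multiset.map_coe, Multiset.map_map]
    refine Multiset.map_congr rfl fun k _ => ?_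
    have h1 : (((A (k + p) - p).toNat : ℕ) : ZMod n) = ((A (k + p) - p : ℤ) : ZMod n) := by
      rw [← Int.cast_natCast, Int.toNat_of_nonneg (hnonneg k)]
    rw [Function.comp_apply, h1]
    push_cast [hpn]
    simp

theorem count_zero_mu (h : (s, i) ∈ lastSet n) :
    (mu n s (-(i : ℤ))).count 0 = s.count i := by
  obtain ⟨hL, hl, hi⟩ := isLandau_of_mem_lastSet h
  rw [mu_eq, Multiset.count_map, ← Multiset.coe_count, Multiset.count_eq_card_filter_eq]
  congr 1
  refine Multiset.filter_congr fun a ha => ?_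
  have ha' : a < n := hl ▸ hL.lt_length (Multiset.mem_coe.mp ha)
  push_cast
  rw [eq_comm, ← sub_eq_add_neg, sub_eq_zero, ZMod.natCast_eq_natCast_iff',
    Nat.mod_eq_of_lt ha', Nat.mod_eq_of_lt hi, eq_comm]

end bijection

/-! ### Generating functions -/

theorem count_dsum {u : List ℕ} (hu : IsLandau u) (v : List ℕ) (i : ℕ) :
    (dsum u v).count (u.length + i) = v.count i := by
  rw [dsum, List.count_append, List.count_eq_zero_of_not_mem fun h => ?_, zero_add, add_comm,
    List.count_map_of_injective v (· + u.length) (add_left_injective u.length)]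
  have := hu.lt_length h
  omega

/-- The last strong summand is determined by the direct sum. -/
theorem dsum_injective {u u' t t' : List ℕ} (hu : IsLandau u) (hu' : IsLandau u')
    (ht : IsStrongLandau t) (ht' : IsStrongLandau t') (h : dsum u t = dsum u' t') :
    u = u' ∧ t = t' := by
  have key : ∀ {u u' t t' : List ℕ}, IsLandau u → IsLandau u' → IsStrongLandau t →
      IsStrongLandau t' → dsum u t = dsum u' t' → ¬ u.length < u'.length := by
    intro u u' t t' hu hu' ht ht' h hlt
    have hlen := congrArg List.length h
    have hpos := List.length_pos_iff.mpr ht'.ne_nil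
    rw [length_dsum, length_dsum] at hlen
    -- Equality in Landau's condition at `u'.length` would be a proper equality inside `t`.
    obtain ⟨j, hj⟩ := Nat.exists_eq_add_of_lt hlt
    have h1 := ht.lt_sum (j + 1) (by omega) (by omega)
    have h2 := sum_take_dsum u (v := t) (k := j + 1) (by omega)
    rw [← add_assoc, ← hj, h, take_dsum _ le_rfl, List.take_length, hu'.sum_eq, hu.sum_eq, hj,
      add_assoc, add_choose_two] at h2
    omega
  have hlen : u.length = u'.length :=
    le_antisymm (not_lt.mp (key hu' hu ht' ht h.symm)) (not_lt.mp (key hu hu' ht ht' h))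
  obtain ⟨h1, h2⟩ := List.append_inj h hlen
  refine ⟨h1, ?_⟩
  rw [hlen] at h2
  exact List.map_injective_iff.mpr (add_left_injective u'.length) h2

theorem finite_lastSet (n : ℕ) : (lastSet n).Finite :=
  ((finite_scoreSeqs n).prod (Set.finite_Iio n)).subset fun _ h => h.1

theorem egzPoly_eq_sum_lastSet {n : ℕ} (hn : 1 ≤ n) :
    egzPoly n = ∑ p ∈ (finite_lastSet n).toFinset, Polynomial.X ^ p.1.count p.2 := by
  have h := bijOn_mu hn
  symm
  refine Finset.sum_bij (fun p _ => mu n p.1 (-(p.2 : ℤ))) ?_ ?_ ?_ ?_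
  · intro p hp
    simpa using h.mapsTo ((finite_lastSet n).mem_toFinset.mp hp)
  · intro p hp q hq hpq
    exact h.injOn ((finite_lastSet n).mem_toFinset.mp hp) ((finite_lastSet n).mem_toFinset.mp hq) hpq
  · intro M hM
    obtain ⟨p, hp, rfl⟩ := h.surjOn ((finite_egz n).mem_toFinset.mp hM)
    exact ⟨p, by simpa using hp, rfl⟩
  · rintro ⟨s, i⟩ hp
    rw [count_zero_mu ((finite_lastSet n).mem_toFinset.mp hp)]

theorem pointedStrongPoly_zero : pointedStrongPoly 0 = 0 := by
  refine Finset.sum_eq_zero ?_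
  rintro ⟨s, i⟩ h
  have := ((finite_pointedStrongSeqs 0).mem_toFinset.mp h).2
  simp at this

/-- A pair in `L_n` consists of an arbitrary score sequence followed by a pointed strong one. -/
theorem sum_lastSet (n : ℕ) :
    ∑ p ∈ (finite_lastSet n).toFinset, (Polynomial.X : Polynomial ℤ) ^ p.1.count p.2 =
      ∑ kl ∈ antidiagonal n,
        ((finite_scoreSeqs kl.1).toFinset.card : Polynomial ℤ) * pointedStrongPoly kl.2 := by
  have h : ∀ kl : ℕ × ℕ,
      ((finite_scoreSeqs kl.1).toFinset.card : Polynomial ℤ) * pointedStrongPoly kl.2 =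
        ∑ x ∈ (finite_scoreSeqs kl.1).toFinset ×ˢ (finite_pointedStrongSeqs kl.2).toFinset,
          Polynomial.X ^ x.2.1.count x.2.2 := fun kl => by
    rw [sum_product]
    simp only [sum_const, nsmul_eq_mul]
    rfl
  simp only [h]
  rw [sum_sigma']
  symm
  refine Finset.sum_bij (fun x _ => (dsum x.2.1 x.2.2.1, x.2.1.length + x.2.2.2)) ?_ ?_ ?_ ?_
  · rintro ⟨⟨k, l⟩, u, t, i⟩ hx
    simp only [mem_sigma, HasAntidiagonal.mem_antidiagonal, mem_product, Set.Finite.mem_toFinset] at hx ⊢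
    obtain ⟨hkl, hu, ht, hi⟩ := hx
    obtain ⟨hu, hul⟩ := mem_scoreSeqs.mp hu
    obtain ⟨ht, htl⟩ := mem_strongSeqs.mp ht
    simp only [Set.mem_Iio] at hi htl
    exact mem_lastSet_iff_dsum.mpr ⟨⟨by rw [length_dsum]; omega, by omega⟩, u, t, hu, ht, rfl,
      by omega⟩
  · rintro ⟨⟨k, l⟩, u, t, i⟩ hx ⟨⟨k', l'⟩, u', t', i'⟩ hx' heq
    simp only [mem_sigma, HasAntidiagonal.mem_antidiagonal, mem_product, Set.Finite.mem_toFinset] at hx hx'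
    obtain ⟨hu, rfl⟩ := mem_scoreSeqs.mp hx.2.1
    obtain ⟨ht, rfl⟩ := mem_strongSeqs.mp hx.2.2.1
    obtain ⟨hu', rfl⟩ := mem_scoreSeqs.mp hx'.2.1
    obtain ⟨ht', rfl⟩ := mem_strongSeqs.mp hx'.2.2.1
    obtain ⟨h1, h2⟩ := Prod.mk.inj heq
    obtain ⟨rfl, rfl⟩ := dsum_injective hu hu' ht ht' h1
    obtain rfl : i = i' := Nat.add_left_cancel h2
    rfl
  · rintro ⟨s, i⟩ hp
    obtain ⟨⟨hl, hi⟩, u, t, hu, ht, rfl, hui⟩ :=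
      mem_lastSet_iff_dsum.mp ((finite_lastSet n).mem_toFinset.mp hp)
    rw [length_dsum] at hl
    refine ⟨⟨(u.length, t.length), u, t, i - u.length⟩, ?_, ?_⟩
    · simp only [mem_sigma, HasAntidiagonal.mem_antidiagonal, mem_product, Set.Finite.mem_toFinset]
      exact ⟨hl, mem_scoreSeqs.mpr ⟨hu, rfl⟩, mem_strongSeqs.mpr ⟨ht, rfl⟩,
        Set.mem_Iio.mpr (by omega)⟩
    · simp [hui]
  · rintro ⟨⟨k, l⟩, u, t, i⟩ hx
    simp only [mem_sigma, mem_product, Set.Finite.mem_toFinset] at hx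
    rw [count_dsum (mem_scoreSeqs.mp hx.2.1).1]

theorem egzSeries_eq : egzSeries = scoreSeries * pointedStrongSeries := by
  ext1 n
  rw [PowerSeries.coeff_mul]
  have hT : ∀ l, PowerSeries.coeff l pointedStrongSeries = pointedStrongPoly l := fun l => by
    rw [pointedStrongSeries, PowerSeries.coeff_mk]
    split_ifs with h
    · rw [h, pointedStrongPoly_zero]
    · rfl
  simp only [hT, scoreSeries, egzSeries, PowerSeries.coeff_mk]
  split_ifs with h
  · simp [h, pointedStrongPoly_zero]
  · rw [egzPoly_eq_sum_lastSet (by omega), sum_lastSet]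

end ScoreSeq

theorem mainTheorem2 :
    (∀ n : ℕ, 1 ≤ n →
      Set.BijOn (fun p : List ℕ × ℕ => ScoreSeq.mu n p.1 (-(p.2 : ℤ)))
        (ScoreSeq.lastSet n) (ScoreSeq.egz n) ∧
      ∀ (s : List ℕ) (i : ℕ), (s, i) ∈ ScoreSeq.lastSet n →
        (ScoreSeq.mu n s (-(i : ℤ))).count 0 = s.count i) ∧
    ScoreSeq.egzSeries = ScoreSeq.scoreSeries * ScoreSeq.pointedStrongSeries :=
  ⟨fun _ hn => ⟨ScoreSeq.bijOn_mu hn, fun _ _ h => ScoreSeq.count_zero_mu h⟩,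
    ScoreSeq.egzSeries_eq⟩
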